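/- **Setting.** Let $X_s\in\mathbb R^d$ ($s\ge 1$) have a common positive $C^1$ density $p$ on $\mathbb R^d$, each $X_s$ being independent of the history $\mathcal F_{s-1}=\sigma(X_1,\hat a_1,Y_1,\dots,X_{s-1},\hat a_{s-1},Y_{s-1})$. In round $s$ an arm $\hat a_s\in\{1,\dots,L\}$ is selected and the reward $Y_s=Y_s(\hat a_s)$ is observed, where $Y_s(j)=f_j(X_s^\top\theta_j)+\varepsilon_s(j)$ with measurable link functions $f_j$, index vectors $\theta_j$ and integrable noise with $\mathbb E[\varepsilon_s(j)\mid\mathcal F_{s-1},X_s]=0$. Put $W_s=-\nabla\log p(X_s)$, $p_{s,j}(W_s)=\mathbb P(\hat a_s=j\mid\mathcal F_{s-1},W_s)$, $$\hat\Gamma_{i,t}=\frac1t\sum_{s=1}^t\frac{\mathbf 1\{\hat a_s=i\}}{p_{s,i}(W_s)}W_sW_s^\top,\quad \hat m_{i,t}=\frac1t\sum_{s=1}^t\frac{\mathbf 1\{\hat a_s=i\}}{p_{s,i}(W_s)}W_sY_s,\quad \hat\beta_{i,t}=\hat\Gamma_{i,t}^{-1}\hat m_{i,t},$$ $\Gamma=\mathbb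 E[W_sW_s^\top]$, $m_i=\mathbb E[W_sY_s(i)]$, $\beta_i=\Gamma^{-1}m_i$ (the first two do not depend on $s$), and $$p_s^\star=\min_{j}\operatorname{ess\,inf}\,p_{s,j}(W_s),\qquad r_t=\frac1{t^2}\sum_{s=1}^t\frac1{p_s^\star}.$$ **Assumptions.** (1) Ignorability: for all $s,j$, the event $\{\hat a_s=j\}$ and $Y_s(j)$ are conditionally independent given $(\mathcal F_{s-1},W_s)$. (2) $p_s^\star>0$ for all $s\ge1$, and $r_t\to0$. (3) $\lambda_{\min}(\Gamma)\ge\mu>0$. (4) For some $\kappa>0$, $\sum_{s\le t}(p_s^\star)^{-(1+\kappa/2)}\big/\big(\sum_{s\le t}(p_s^\star)^{-1}\big)^{1+\kappa/2}\to0$ as $t\to\infty$, and $\sup_s\mathbb E\|W_sY_s(i)\|^{2+\kappa}<\infty$. (5) For all $s$: $\mathbb E\|W_s\|^2\le M_2$, $\mathbb E\|W_s\|^4\le M_4$, $\mathbb E\|W_s\|^8\le M_8$, $\mathbb E|Y_s(i)|^2\le\tilde M_2$, $\mathbb E|Y_s(i)|^4\le\tilde M_4$. **Theorem.** There are absolute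 constants $c_*,\tilde c_*>0$ and finite constants $C_*,\tilde M_8,\tilde C_*>0$ and $m_2,\tilde C_2,\tilde c_2,\tilde C_3\ge0$, depending only on $M_2,M_4,M_8,\tilde M_2,\tilde M_4$, such that under these assumptions the following holds for all $t\ge1$ and all $\delta_\Gamma,\eta_\Gamma,\delta_m,\eta_m\in(0,1/2)$. Let $$u_\Gamma^2=\frac2{c_*}\max\Big\{\log\frac1{\eta_\Gamma},\log\frac{M_8C_*(t r_t+1)}{\eta_\Gamma^2}\Big\},\qquad u_m^2=\frac2{\tilde c_*}\max\Big\{\log\frac1{\eta_m},\log\frac{\tilde M_8\tilde C_*(t r_t+1)}{\eta_m^2}\Big\},$$ $$B_\Gamma=\frac43u_\Gamma^2\frac{\log(2d/\delta_\Gamma)}t+\sqrt{\Big(4M_4r_t+\frac{4m_2^2}t\Big)\log\frac{2d}{\delta_\Gamma}}+\sqrt{\frac{M_4}{\delta_\Gamma}}\sqrt{r_t}+\eta_\Gamma,$$ $$B_m=\frac43u_m^2\frac{\log(2d/\delta_m)}t+\sqrt{\Big(\tilde C_2r_t+\frac{\tilde c_2}t\Big)\log\frac{2d}{\delta_m}}+\sqrt{\frac{\tilde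 C_3}{\delta_m}}\sqrt{r_t}+\eta_m$$ If $B_\Gamma<\mu$, then with probability at least $1-(2\delta_\Gamma+\eta_\Gamma)-(2\delta_m+\eta_m)$ the matrix $\hat\Gamma_{i,t}$ is invertible and $$\|\hat\beta_{i,t}-\beta_i\|\le\frac{B_m}\mu+\frac{B_\Gamma}{\mu^2-\mu B_\Gamma}\big(\|m_i\|+B_m\big).$$ In particular, if $B_\Gamma\le\mu/2$, then with at least the same probability $\hat\Gamma_{i,t}$ is invertible and $$\|\hat\beta_{i,t}-\beta_i\|\le\frac{B_m}\mu+\frac2{\mu^2}B_\Gamma\big(\|m_i\|+B_m\big).$$ -/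

import Mathlib

open MeasureTheory ProbabilityTheory Filter
open scoped NNReal ENNReal Topology

noncomputable section

namespace KSIB

/-- The score `S(x) = -∇ log p(x)` of a density `p` on `ℝᵈ`. -/
def score {d : ℕ} (p : EuclideanSpace ℝ (Fin d) → ℝ) (x : EuclideanSpace ℝ (Fin d)) :
    EuclideanSpace ℝ (Fin d) :=
  -gradient (fun y => Real.log (p y)) x

/-- The objects of a single-index bandit with `L` arms and `d`-dimensional covariates.
Rounds are numbered `1, 2, 3, …`; the index `0` is never used. What is assumed of these objects is
stated in `IsSingleIndexBandit`. -/
structure Bandit (Ω : Type*) (d L : ℕ) where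
  /-- density of the covariates -/
  density : EuclideanSpace ℝ (Fin d) → ℝ
  /-- link function of each arm -/
  link : Fin L → ℝ → ℝ
  /-- index parameter of each arm in the model for the rewards -/
  index : Fin L → EuclideanSpace ℝ (Fin d)
  /-- covariate `X_s` -/
  X : ℕ → Ω → EuclideanSpace ℝ (Fin d)
  /-- noise `ε_s(i)` in the reward that arm `i` gives in round `s` -/
  noise : ℕ → Fin L → Ω → ℝ
  /-- arm selected in round `s` -/
  arm : ℕ → Ω → Fin L

namespace Bandit

variable {Ω : Type*} {d L : ℕ}

/-- The score feature `W_s = S(X_s)`. -/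
def W (B : Bandit Ω d L) (s : ℕ) (ω : Ω) : EuclideanSpace ℝ (Fin d) :=
  score B.density (B.X s ω)

/-- The reward `Y_s(i)` of arm `i` in round `s` (observed only if arm `i` is selected). -/
def armReward (B : Bandit Ω d L) (s : ℕ) (i : Fin L) (ω : Ω) : ℝ :=
  B.link i (inner ℝ (B.X s ω) (B.index i)) + B.noise s i ω

/-- The observed reward `Y_s`. -/
def Y (B : Bandit Ω d L) (s : ℕ) (ω : Ω) : ℝ :=
  B.armReward s (B.arm s ω) ω

/-- The history `𝓕_{s-1} = σ(X_1, a_1, Y_1, …, X_{s-1}, a_{s-1}, Y_{s-1})` before round `s`. -/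
abbrev past (B : Bandit Ω d L) (s : ℕ) : MeasurableSpace Ω :=
  ⨆ r ∈ Finset.Ico 1 s,
    MeasurableSpace.comap (B.X r) inferInstance ⊔ MeasurableSpace.comap (B.arm r) inferInstance ⊔
      MeasurableSpace.comap (B.Y r) inferInstance

/-- The σ-algebra `σ(𝓕_{s-1}, W_s)`. -/
abbrev pastW (B : Bandit Ω d L) (s : ℕ) : MeasurableSpace Ω :=
  B.past s ⊔ MeasurableSpace.comap (B.W s) inferInstance

/-- The σ-algebra `σ(𝓕_{s-1}, X_s)`. -/
abbrev pastX (B : Bandit Ω d L) (s : ℕ) : MeasurableSpace Ω :=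
  B.past s ⊔ MeasurableSpace.comap (B.X s) inferInstance

variable [MeasurableSpace Ω]

/-- The propensity `p_{s,i}(W_s) = ℙ(a_s = i ∣ 𝓕_{s-1}, W_s)`. -/
def propensity (B : Bandit Ω d L) (P : Measure Ω) (s : ℕ) (i : Fin L) : Ω → ℝ :=
  P⟦{ω | B.arm s ω = i} | B.pastW s⟧

open Classical in
/-- The inverse-propensity weight `1{a_s = i} / p_{s,i}(W_s)`. -/
def weight (B : Bandit Ω d L) (P : Measure Ω) (s : ℕ) (i : Fin L) (ω : Ω) : ℝ :=
  (if B.arm s ω = i then 1 else 0) / B.propensity P s i ω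

/-- The weighted Gram matrix `Γ̂_{i,t} = t⁻¹ ∑_{s ≤ t} 1{a_s = i} / p_{s,i}(W_s) W_s W_sᵀ`. -/
def gramHat (B : Bandit Ω d L) (P : Measure Ω) (i : Fin L) (t : ℕ) (ω : Ω) :
    Matrix (Fin d) (Fin d) ℝ :=
  (t : ℝ)⁻¹ • ∑ s ∈ Finset.Icc 1 t,
    B.weight P s i ω • Matrix.of fun j k => B.W s ω j * B.W s ω k

/-- The weighted moment `m̂_{i,t} = t⁻¹ ∑_{s ≤ t} 1{a_s = i} / p_{s,i}(W_s) W_s Y_s`. -/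
def momentHat (B : Bandit Ω d L) (P : Measure Ω) (i : Fin L) (t : ℕ) (ω : Ω) :
    EuclideanSpace ℝ (Fin d) :=
  (t : ℝ)⁻¹ • ∑ s ∈ Finset.Icc 1 t, (B.weight P s i ω * B.Y s ω) • B.W s ω

/-- The estimator `β̂_{i,t} = Γ̂_{i,t}⁻¹ m̂_{i,t}`. -/
def betaHat (B : Bandit Ω d L) (P : Measure Ω) (i : Fin L) (t : ℕ) (ω : Ω) :
    EuclideanSpace ℝ (Fin d) :=
  (B.gramHat P i t ω)⁻¹.toEuclideanLin (B.momentHat P i t ω)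

/-- The population Gram matrix `Γ = 𝔼[W Wᵀ]`. The covariates have the same law in all rounds, and
the first round is taken. -/
def gram (B : Bandit Ω d L) (P : Measure Ω) : Matrix (Fin d) (Fin d) ℝ :=
  Matrix.of fun j k => ∫ ω, B.W 1 ω j * B.W 1 ω k ∂P

/-- The population moment `m_i = 𝔼[W Y(i)]`. It is the same in all rounds, because the covariates
have the same law and the noise is centred given the covariate; the first round is taken. -/
def moment (B : Bandit Ω d L) (P : Measure Ω) (i : Fin L) : EuclideanSpace ℝ (Fin d) :=
  ∫ ω, B.armReward 1 i ω • B.W 1 ω ∂P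

/-- The target `β_i = Γ⁻¹ m_i`. -/
def beta (B : Bandit Ω d L) (P : Measure Ω) (i : Fin L) : EuclideanSpace ℝ (Fin d) :=
  (B.gram P)⁻¹.toEuclideanLin (B.moment P i)

/-- The minimal propensity `p_s⋆`: the minimum over the arms of the essential infimum of the
propensity in round `s`. -/
def minPropensity (B : Bandit Ω d L) (P : Measure Ω) (s : ℕ) : ℝ :=
  ⨅ i : Fin L, essInf (B.propensity P s i) P

/-- The exploration complexity `r_t = t⁻² ∑_{s ≤ t} 1 / p_s⋆`. -/
def r (B : Bandit Ω d L) (P : Measure Ω) (t : ℕ) : ℝ :=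
  (∑ s ∈ Finset.Icc 1 t, 1 / B.minPropensity P s) / (t : ℝ) ^ 2

/-- The single-index bandit model. -/
structure IsSingleIndexBandit (B : Bandit Ω d L) (P : Measure Ω) : Prop where
  measurable_link : ∀ i, Measurable (B.link i)
  measurable_X : ∀ s, 1 ≤ s → Measurable (B.X s)
  measurable_noise : ∀ s, 1 ≤ s → ∀ i, Measurable (B.noise s i)
  measurable_arm : ∀ s, 1 ≤ s → Measurable (B.arm s)
  /-- the covariates have a positive, continuously differentiable density, … -/
  contDiff_density : ContDiff ℝ 1 B.density
  density_pos : ∀ x, 0 < B.density x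
  law_X : ∀ s, 1 ≤ s → P.map (B.X s) = volume.withDensity fun x => ENNReal.ofReal (B.density x)
  /-- … and each covariate is drawn independently of the history -/
  indep_X : ∀ s, 1 ≤ s → Indep (MeasurableSpace.comap (B.X s) inferInstance) (B.past s) P
  /-- the noise is centred given the history and the covariate -/
  integrable_noise : ∀ s, 1 ≤ s → ∀ i, Integrable (B.noise s i) P
  noise_centred : ∀ s, 1 ≤ s → ∀ i, P[B.noise s i | B.pastX s] =ᵐ[P] 0

/-- Ignorability: given `(𝓕_{s-1}, W_s)`, whether arm `i` is selected in round `s` is conditionally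
independent of the reward `Y_s(i)`. -/
def Ignorable (B : Bandit Ω d L) (P : Measure Ω) : Prop :=
  ∀ s, 1 ≤ s → ∀ i, ∀ T : Set ℝ, MeasurableSet T →
    P⟦{ω | B.arm s ω = i} ∩ B.armReward s i ⁻¹' T | B.pastW s⟧ =ᵐ[P]
      P⟦{ω | B.arm s ω = i} | B.pastW s⟧ * P⟦B.armReward s i ⁻¹' T | B.pastW s⟧

/-- Average exploration: the minimal propensities are positive and `r_t → 0`. -/
def AverageExploration (B : Bandit Ω d L) (P : Measure Ω) : Prop :=
  (∀ s, 1 ≤ s → 0 < B.minPropensity P s) ∧ Tendsto (B.r P) atTop (𝓝 0)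

/-- No dominant inverse-propensity weight:
`∑_{s ≤ t} (p_s⋆)^{-(1+κ/2)} / (∑_{s ≤ t} (p_s⋆)^{-1})^{1+κ/2} → 0`. -/
def NoDominantWeight (B : Bandit Ω d L) (P : Measure Ω) (κ : ℝ) : Prop :=
  Tendsto (fun t : ℕ =>
    (∑ s ∈ Finset.Icc 1 t, B.minPropensity P s ^ (-(1 + κ / 2))) /
      (∑ s ∈ Finset.Icc 1 t, (B.minPropensity P s)⁻¹) ^ (1 + κ / 2)) atTop (𝓝 0)

/-- Moment envelopes for the features and for the rewards of arm `i`. -/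
structure MomentEnvelopes (B : Bandit Ω d L) (P : Measure Ω) (i : Fin L)
    (M₂ M₄ M₈ N₂ N₄ : ℝ≥0) (κ : ℝ) : Prop where
  feature_two : ∀ s, 1 ≤ s → ∫⁻ ω, ‖B.W s ω‖ₑ ^ 2 ∂P ≤ M₂
  feature_four : ∀ s, 1 ≤ s → ∫⁻ ω, ‖B.W s ω‖ₑ ^ 4 ∂P ≤ M₄
  feature_eight : ∀ s, 1 ≤ s → ∫⁻ ω, ‖B.W s ω‖ₑ ^ 8 ∂P ≤ M₈
  reward_two : ∀ s, 1 ≤ s → ∫⁻ ω, ‖B.armReward s i ω‖ₑ ^ 2 ∂P ≤ N₂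
  reward_four : ∀ s, 1 ≤ s → ∫⁻ ω, ‖B.armReward s i ω‖ₑ ^ 4 ∂P ≤ N₄
  product : ∃ C : ℝ≥0, ∀ s, 1 ≤ s → ∫⁻ ω, ‖B.armReward s i ω • B.W s ω‖ₑ ^ (2 + κ) ∂P ≤ C

end Bandit

/-- The squared truncation level
`u² = (2 / c) max {log (1 / η), log (K (t r + 1) / η²)}`. -/
def truncSq (c K : ℝ) (t : ℕ) (r η : ℝ) : ℝ :=
  2 / c * max (Real.log (1 / η)) (Real.log (K * (t * r + 1) / η ^ 2))

/-- The deviation bound `B_Γ(t; δ, η)` for the Gram matrix. -/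
def gramBound (c C M₄ M₈ m₂ : ℝ) (d t : ℕ) (r δ η : ℝ) : ℝ :=
  4 / 3 * truncSq c (M₈ * C) t r η * (Real.log (2 * d / δ) / t)
    + √((4 * M₄ * r + 4 * m₂ ^ 2 / t) * Real.log (2 * d / δ))
    + √(M₄ / δ) * √r + η

/-- The deviation bound `B_m(t; δ, η)` for the moment vector. -/
def momentBound (c C M₈ C₂ c₂ C₃ : ℝ) (d t : ℕ) (r δ η : ℝ) : ℝ :=
  4 / 3 * truncSq c (M₈ * C) t r η * (Real.log (2 * d / δ) / t)
    + √((C₂ * r + c₂ / t) * Real.log (2 * d / δ))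
    + √(C₃ / δ) * √r + η

end KSIB

end

/-! Chebyshev's inequality suffices. The summands `√(M₄ / δ) * √r` of `gramBound` and `√(C₃ / δ) *
√r` of `momentBound` already cover what it gives; all other summands are nonnegative and only
enlarge the bounds.

By ignorability, on the σ-algebra generated by the history, `W_s` and `Y_s(i)`, the propensity is
the density of `P` restricted to `{a_s = i}` (`trim_restrict_eq_trim_withDensity`). Hence
inverse-propensity weighting preserves integrals (`integral_mul_weighted`) and inflates second
moments by at most `1 / p_s⋆` (`memLp_two_weighted`). The centred weighted terms of different rounds
are therefore orthogonal in `L²`, and the weighted average of `g s` has mean squared error at most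
`t⁻² ∑ 𝔼[g s ^ 2] / p_s⋆` (`integral_sq_weighted_average_sub_le`).

Summed over coordinates, this bounds the squared Frobenius error of the Gram matrix by `M₄ r_t` and
the squared error of the moment by `(M₄ + N₄) / 2 * r_t`. Outside an event of probability at most
`δΓ + δm` both errors are within their bounds, and the claim becomes a deterministic statement on
linear systems (`isUnit_and_norm_inv_sub_inv_le`). -/

namespace KSIB

/-! ### Deterministic perturbation of a linear system. -/

section Perturbation

variable {d : ℕ}

/-- Cauchy–Schwarz in each row: the Frobenius norm, which second moments of the entries control,
dominates the operator norm. -/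
lemma norm_toEuclideanLin_le_of_sum_sq_le (A : Matrix (Fin d) (Fin d) ℝ) {b : ℝ} (hb : 0 ≤ b)
    (hA : ∑ j, ∑ k, A j k ^ 2 ≤ b ^ 2) (v : EuclideanSpace ℝ (Fin d)) :
    ‖A.toEuclideanLin v‖ ≤ b * ‖v‖ := by
  refine abs_le_of_sq_le_sq' ?_ (by positivity) |>.2
  rw [mul_pow, EuclideanSpace.real_norm_sq_eq, EuclideanSpace.real_norm_sq_eq]
  calc ∑ j, (A.toEuclideanLin v j) ^ 2
      ≤ ∑ j, (∑ k, A j k ^ 2) * ∑ k, v k ^ 2 := by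
        refine Finset.sum_le_sum fun j _ => ?_
        have : A.toEuclideanLin v j = ∑ k, A j k * v k := by
          simp [Matrix.toEuclideanLin, Matrix.toLpLin_apply, Matrix.mulVec, dotProduct]
        rw [this]
        exact Finset.sum_mul_sq_le_sq_mul_sq _ _ _
    _ = (∑ j, ∑ k, A j k ^ 2) * ∑ k, v k ^ 2 := by rw [Finset.sum_mul]
    _ ≤ _ := by gcongr

/-- Subtracting `μ` shifts the spectrum into the nonnegative half-line, so the quadratic form of `A`
is at least `μ ‖v‖ ^ 2`; Cauchy–Schwarz then gives the bound on the norm. -/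
lemma le_norm_toEuclideanLin_of_spectrum (A : Matrix (Fin d) (Fin d) ℝ) (hA : A.IsHermitian)
    {μ : ℝ} (hμ : ∀ l ∈ spectrum ℝ A, μ ≤ l) (v : EuclideanSpace ℝ (Fin d)) :
    μ * ‖v‖ ≤ ‖A.toEuclideanLin v‖ := by
  have hH : (A - Matrix.scalar (Fin d) μ).IsHermitian := by
    refine hA.sub ?_
    simp [Matrix.IsHermitian]
  have hpsd : (A - Matrix.scalar (Fin d) μ).PosSemidef := by
    rw [hH.posSemidef_iff_eigenvalues_nonneg]
    intro j
    have h1 : hH.eigenvalues j ∈ spectrum ℝ (A - algebraMap ℝ _ μ) := by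
      have := hH.eigenvalues_mem_spectrum_real j
      exact this
    rw [← spectrum.sub_singleton_eq] at h1
    obtain ⟨l, hl, x, rfl, hx⟩ := h1
    have := hμ l hl
    simp only at hx
    change 0 ≤ hH.eigenvalues j
    linarith
  have h2 := hpsd.dotProduct_mulVec_nonneg v.ofLp
  have h3 : μ * ‖v‖ ^ 2 ≤ inner ℝ v (A.toEuclideanLin v) := by
    rw [Matrix.sub_mulVec, dotProduct_sub] at h2
    have e1 : inner ℝ v (A.toEuclideanLin v) = star v.ofLp ⬝ᵥ (A.mulVec v.ofLp) := by
      rw [PiLp.inner_apply]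
      simp [Matrix.toEuclideanLin, Matrix.toLpLin_apply, dotProduct, mul_comm]
    have e2 : μ * ‖v‖ ^ 2 = star v.ofLp ⬝ᵥ ((Matrix.scalar (Fin d) μ).mulVec v.ofLp) := by
      rw [EuclideanSpace.real_norm_sq_eq, Finset.mul_sum]
      simp only [dotProduct, Matrix.scalar_apply, Matrix.mulVec_diagonal, star_trivial]
      exact Finset.sum_congr rfl fun _ _ => by ring
    rw [e1, e2]; linarith
  have h4 := real_inner_le_norm v (A.toEuclideanLin v)
  rcases (norm_nonneg v).eq_or_lt with h | h
  · rw [← h]; simp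
  · refine le_of_mul_le_mul_left ?_ h
    nlinarith

lemma isUnit_of_le_norm_toEuclideanLin (A : Matrix (Fin d) (Fin d) ℝ) {c : ℝ} (hc : 0 < c)
    (hA : ∀ v, c * ‖v‖ ≤ ‖A.toEuclideanLin v‖) : IsUnit A := by
  rw [← Matrix.mulVec_injective_iff_isUnit]
  intro x y hxy
  have := hA (WithLp.toLp 2 (x - y))
  have h0 : A.toEuclideanLin (WithLp.toLp 2 (x - y)) = 0 := by
    simp [Matrix.toEuclideanLin, Matrix.toLpLin_apply, Matrix.mulVec_sub]
    simpa [sub_eq_zero] using hxy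
  rw [h0, norm_zero] at this
  have h1 : ‖WithLp.toLp 2 (x - y)‖ = 0 :=
    le_antisymm (by nlinarith [norm_nonneg (WithLp.toLp 2 (x - y))]) (norm_nonneg _)
  have h2 := norm_eq_zero.1 h1
  have h3 : x - y = 0 := congrArg WithLp.ofLp h2
  exact sub_eq_zero.1 h3

lemma toEuclideanLin_apply_inv_apply {A : Matrix (Fin d) (Fin d) ℝ} (hA : IsUnit A)
    (v : EuclideanSpace ℝ (Fin d)) : A.toEuclideanLin (A⁻¹.toEuclideanLin v) = v := by
  have := (Matrix.isUnit_iff_isUnit_det A).1 hA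
  simp [Matrix.toEuclideanLin, Matrix.toLpLin_apply, Matrix.mul_nonsing_inv _ this]

/-- Perturbation bound for the solution of a linear system whose matrix is symmetric with spectrum
bounded below by `μ`. -/
lemma isUnit_and_norm_inv_sub_inv_le {A G : Matrix (Fin d) (Fin d) ℝ}
    {x m : EuclideanSpace ℝ (Fin d)} {μ a b : ℝ} (hG : G.IsHermitian)
    (hμ : ∀ l ∈ spectrum ℝ G, μ ≤ l) (hμ0 : 0 < μ) (ha : 0 ≤ a) (haμ : a < μ)
    (hA : ∑ j, ∑ k, (A j k - G j k) ^ 2 ≤ a ^ 2) (hx : ‖x - m‖ ≤ b) :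
    IsUnit A ∧ ‖A⁻¹.toEuclideanLin x - G⁻¹.toEuclideanLin m‖ ≤
      1 / μ * b + a / (μ ^ 2 - μ * a) * (‖m‖ + b) := by
  have hGv := le_norm_toEuclideanLin_of_spectrum G hG hμ
  have hD : ∀ v, ‖A.toEuclideanLin v - G.toEuclideanLin v‖ ≤ a * ‖v‖ := by
    intro v
    have := norm_toEuclideanLin_le_of_sum_sq_le (A - G) ha (by simpa using hA) v
    simpa using this
  have hAv : ∀ v, (μ - a) * ‖v‖ ≤ ‖A.toEuclideanLin v‖ := by
    intro v
    have h1 := norm_sub_norm_le (G.toEuclideanLin v) (A.toEuclideanLin v)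
    rw [norm_sub_rev] at h1
    linarith [hGv v, hD v]
  have hAu := isUnit_of_le_norm_toEuclideanLin A (sub_pos.2 haμ) hAv
  have hGu := isUnit_of_le_norm_toEuclideanLin G hμ0 hGv
  refine ⟨hAu, ?_⟩
  set y := A⁻¹.toEuclideanLin x with hy
  set z := G⁻¹.toEuclideanLin m with hz
  have hAy : A.toEuclideanLin y = x := toEuclideanLin_apply_inv_apply hAu x
  have hGz : G.toEuclideanLin z = m := toEuclideanLin_apply_inv_apply hGu m
  -- The solution of the perturbed system is bounded through `A` itself, whose lower bound `μ - a`
  -- survives the perturbation.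
  have hyn : (μ - a) * ‖y‖ ≤ ‖m‖ + b := by
    have := hAv y
    rw [hAy] at this
    linarith [norm_sub_norm_le x m]
  have hyn' : ‖y‖ ≤ (‖m‖ + b) / (μ - a) := by
    rw [le_div_iff₀ (sub_pos.2 haμ)]; linarith
  -- Resolvent identity: the error solves the unperturbed system with right-hand side `(x - m) - (A
  -- - G) y`.
  have h1 : G.toEuclideanLin (y - z) = (x - m) - (A.toEuclideanLin y - G.toEuclideanLin y) := by
    rw [map_sub, hAy, hGz]; abel
  have h2 : μ * ‖y - z‖ ≤ b + a * ((‖m‖ + b) / (μ - a)) := by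
    calc μ * ‖y - z‖ ≤ _ := hGv _
      _ ≤ ‖x - m‖ + ‖A.toEuclideanLin y - G.toEuclideanLin y‖ := by
        rw [h1]; exact norm_sub_le _ _
      _ ≤ b + a * ‖y‖ := add_le_add hx (hD y)
      _ ≤ _ := by gcongr
  have h3 : 1 / μ * b + a / (μ ^ 2 - μ * a) * (‖m‖ + b) =
      (b + a * ((‖m‖ + b) / (μ - a))) / μ := by
    have : μ - a ≠ 0 := (sub_pos.2 haμ).ne'
    have e : μ ^ 2 - μ * a = μ * (μ - a) := by ring
    rw [e]; field_simp
  rw [h3, le_div_iff₀ hμ0]; linarith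

end Perturbation

/-! ### Inverse-propensity weighting under conditional independence. -/

section Weighting

variable {Ω : Type*} {m m0 : MeasurableSpace Ω} {P : Measure Ω}

lemma condExp_indicator_one_nonneg (A : Set Ω) : 0 ≤ᵐ[P] P⟦A | m⟧ :=
  condExp_nonneg (Eventually.of_forall fun _ => Set.indicator_nonneg (fun _ _ => zero_le_one) _)

/-- Pythagoras in `L²`. Orthogonality is asked only for `r < s`, the form that conditioning on the
history of the later round provides; symmetry covers the other pairs. -/
lemma integral_sum_sq_of_orthogonal {D : ℕ → Ω → ℝ} {S : Finset ℕ}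
    (hD : ∀ s ∈ S, MemLp (D s) 2 P)
    (ho : ∀ s ∈ S, ∀ r ∈ S, r < s → ∫ ω, D r ω * D s ω ∂P = 0) :
    ∫ ω, (∑ s ∈ S, D s ω) ^ 2 ∂P = ∑ s ∈ S, ∫ ω, D s ω ^ 2 ∂P := by
  have hi : ∀ r ∈ S, ∀ s ∈ S, Integrable (fun ω => D r ω * D s ω) P :=
    fun r hr s hs => (hD r hr).integrable_mul (hD s hs)
  simp_rw [sq, Finset.sum_mul_sum]
  rw [integral_finsetSum _ fun r hr => integrable_finsetSum _ fun s hs => hi r hr s hs]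
  refine Finset.sum_congr rfl fun r hr => ?_
  rw [integral_finsetSum _ fun s hs => hi r hr s hs]
  refine Finset.sum_eq_single_of_mem r hr fun s hs hsr => ?_
  rcases lt_or_gt_of_ne hsr with hlt | hlt
  · simp_rw [mul_comm (D r _)]; exact ho r hr s hs hlt
  · exact ho s hs r hr hlt

variable [IsProbabilityMeasure P]

/-- If an event `A` is conditionally independent of a random variable `V` given `m`, then its
conditional probability given `m` is its density on the larger σ-algebra `m ⊔ σ(V)`. -/
lemma trim_restrict_eq_trim_withDensity (hm : m ≤ m0) {V : Ω → ℝ} (hV : Measurable V)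
    (hm' : m ⊔ MeasurableSpace.comap V inferInstance ≤ m0) {A : Set Ω} (hA : MeasurableSet A)
    (h : ∀ T : Set ℝ, MeasurableSet T →
      P⟦A ∩ V ⁻¹' T | m⟧ =ᵐ[P] P⟦A | m⟧ * P⟦V ⁻¹' T | m⟧) :
    (P.restrict A).trim hm' =
      (P.withDensity fun ω => ENNReal.ofReal ((P⟦A | m⟧) ω)).trim hm' := by
  set q : Ω → ℝ := P⟦A | m⟧ with hq
  have hq0 : 0 ≤ᵐ[P] q := condExp_indicator_one_nonneg A
  have hqint : Integrable q P := integrable_condExp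
  -- The two measures are compared on sets `E ∩ V ⁻¹' T`: conditional independence factors the
  -- conditional probability, and the `m`-measurable factor `q` is pulled back inside the
  -- conditional expectation. These sets form a π-system generating `m ⊔ σ(V)`.
  have key : ∀ E, MeasurableSet[m] E → ∀ T : Set ℝ, MeasurableSet T →
      P (E ∩ V ⁻¹' T ∩ A) = ∫⁻ ω in E ∩ V ⁻¹' T, ENNReal.ofReal (q ω) ∂P := by
    intro E hE T hT
    have hVT : MeasurableSet (V ⁻¹' T) := hV hT
    rw [← ofReal_integral_eq_lintegral_ofReal hqint.restrict (ae_restrict_of_ae hq0),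
      ← ofReal_measureReal (μ := P)]
    congr 1
    have hi : Integrable ((V ⁻¹' T).indicator fun _ => (1 : ℝ)) P :=
      (integrable_const 1).indicator hVT
    have e1 : (q * (V ⁻¹' T).indicator fun _ => (1 : ℝ)) = (V ⁻¹' T).indicator q := by
      ext ω; by_cases hω : ω ∈ V ⁻¹' T <;> simp [hω]
    have hqi : Integrable (q * (V ⁻¹' T).indicator fun _ => (1 : ℝ)) P := by
      rw [e1]; exact hqint.indicator hVT
    calc P.real (E ∩ V ⁻¹' T ∩ A)
        = ∫ ω in E, (A ∩ V ⁻¹' T).indicator (fun _ => (1 : ℝ)) ω ∂P := by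
          rw [integral_indicator_const _ (hA.inter hVT), smul_eq_mul, mul_one,
            measureReal_restrict_apply (hA.inter hVT)]
          congr 1; ext ω; simp only [Set.mem_inter_iff]; tauto
      _ = ∫ ω in E, (P⟦A ∩ V ⁻¹' T | m⟧) ω ∂P :=
          (setIntegral_condExp hm ((integrable_const 1).indicator (hA.inter hVT)) hE).symm
      _ = ∫ ω in E, (P[q * (V ⁻¹' T).indicator fun _ => (1 : ℝ) | m]) ω ∂P := by
          refine setIntegral_congr_ae (hm _ hE) ?_
          filter_upwards [h T hT, condExp_mul_of_stronglyMeasurable_left (m := m) (μ := P)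
            (stronglyMeasurable_condExp : StronglyMeasurable[m] q) hqi hi] with ω h1 h2 _
          rw [h1, h2]
      _ = ∫ ω in E, (q * (V ⁻¹' T).indicator fun _ => (1 : ℝ)) ω ∂P :=
          setIntegral_condExp hm hqi hE
      _ = ∫ ω in E ∩ V ⁻¹' T, q ω ∂P := by
          rw [e1, setIntegral_indicator hVT]
  have hfin : IsFiniteMeasure (P.withDensity fun ω => ENNReal.ofReal (q ω)) :=
    isFiniteMeasure_withDensity_ofReal hqint.2
  have hgen : m ⊔ MeasurableSpace.comap V inferInstance = MeasurableSpace.generateFrom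
      {S | ∃ E, MeasurableSet[m] E ∧ ∃ T : Set ℝ, MeasurableSet T ∧ E ∩ V ⁻¹' T = S} := by
    refine le_antisymm (sup_le ?_ ?_) (MeasurableSpace.generateFrom_le ?_)
    · intro E hE
      exact MeasurableSpace.measurableSet_generateFrom ⟨E, hE, Set.univ, .univ, by simp⟩
    · rintro _ ⟨T, hT, rfl⟩
      exact MeasurableSpace.measurableSet_generateFrom
        ⟨Set.univ, @MeasurableSet.univ _ m, T, hT, by simp⟩
    · rintro _ ⟨E, hE, T, hT, rfl⟩
      exact MeasurableSet.inter ((le_sup_left : m ≤ m ⊔ _) _ hE)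
        ((le_sup_right : MeasurableSpace.comap V inferInstance ≤ m ⊔ _) _ ⟨T, hT, rfl⟩)
  have hpi : IsPiSystem
      {S | ∃ E, MeasurableSet[m] E ∧ ∃ T : Set ℝ, MeasurableSet T ∧ E ∩ V ⁻¹' T = S} := by
    rintro _ ⟨E, hE, T, hT, rfl⟩ _ ⟨E', hE', T', hT', rfl⟩ -
    refine ⟨E ∩ E', @MeasurableSet.inter _ m _ _ hE hE', T ∩ T', hT.inter hT', ?_⟩
    rw [Set.preimage_inter, Set.inter_inter_inter_comm]
  refine @ext_of_generate_finite Ω (m ⊔ MeasurableSpace.comap V inferInstance) _ _ _ hgen hpi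
    _ ?_ ?_
  · rintro _ ⟨E, hE, T, hT, rfl⟩
    have hS : MeasurableSet[m ⊔ MeasurableSpace.comap V inferInstance] (E ∩ V ⁻¹' T) := by
      rw [hgen]; exact MeasurableSpace.measurableSet_generateFrom ⟨E, hE, T, hT, rfl⟩
    rw [trim_measurableSet_eq hm' hS, trim_measurableSet_eq hm' hS,
      Measure.restrict_apply (hm' _ hS), withDensity_apply _ (hm' _ hS)]
    exact key E hE T hT
  · have := key Set.univ (@MeasurableSet.univ _ m) Set.univ .univ
    rw [trim_measurableSet_eq hm' .univ, trim_measurableSet_eq hm' .univ,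
      Measure.restrict_apply .univ, withDensity_apply _ .univ]
    simpa using this

/-- Second moment of an inverse-propensity weighted variable. -/
lemma memLp_two_weighted (hm : m ≤ m0) {V : Ω → ℝ} (hV : Measurable V) {A : Set Ω}
    (hA : MeasurableSet A)
    (h : ∀ T : Set ℝ, MeasurableSet T →
      P⟦A ∩ V ⁻¹' T | m⟧ =ᵐ[P] P⟦A | m⟧ * P⟦V ⁻¹' T | m⟧)
    {p : ℝ} (hp : 0 < p) (hq : ∀ᵐ ω ∂P, p ≤ (P⟦A | m⟧) ω) {g : Ω → ℝ}
    (hg : Measurable[m ⊔ MeasurableSpace.comap V inferInstance] g) (hg2 : MemLp g 2 P) :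
    MemLp (A.indicator fun ω => g ω / (P⟦A | m⟧) ω) 2 P ∧
      ∫ ω, (A.indicator (fun ω => g ω / (P⟦A | m⟧) ω) ω) ^ 2 ∂P ≤ 1 / p * ∫ ω, g ω ^ 2 ∂P := by
  have hm' : m ⊔ MeasurableSpace.comap V inferInstance ≤ m0 := sup_le hm hV.comap_le
  have htrim := trim_restrict_eq_trim_withDensity (P := P) hm hV hm' hA h
  set q : Ω → ℝ := P⟦A | m⟧ with hqdef
  have hqm : Measurable[m] q := stronglyMeasurable_condExp.measurable
  have hqm' : Measurable[m ⊔ MeasurableSpace.comap V inferInstance] q :=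
    hqm.mono le_sup_left le_rfl
  have hF : Measurable[m ⊔ MeasurableSpace.comap V inferInstance]
      fun ω => ENNReal.ofReal ((g ω / q ω) ^ 2) :=
    ENNReal.measurable_ofReal.comp ((hg.div hqm').pow_const 2)
  have hI : Integrable (fun ω => 1 / p * g ω ^ 2) P := hg2.integrable_sq.const_mul _
  have hle : ∫⁻ ω in A, ENNReal.ofReal ((g ω / q ω) ^ 2) ∂P ≤
      ENNReal.ofReal (1 / p * ∫ ω, g ω ^ 2 ∂P) := by
    rw [← lintegral_trim hm' hF, htrim, lintegral_trim hm' hF,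
      lintegral_withDensity_eq_lintegral_mul _ (hqm.mono hm le_rfl).ennreal_ofReal
        (hF.mono hm' le_rfl), ← integral_const_mul,
      ofReal_integral_eq_lintegral_ofReal hI (Eventually.of_forall fun _ => by positivity)]
    refine lintegral_mono_ae ?_
    filter_upwards [hq] with ω hω
    have hq0 : 0 < q ω := hp.trans_le hω
    rw [Pi.mul_apply, ← ENNReal.ofReal_mul hq0.le]
    refine ENNReal.ofReal_le_ofReal ?_
    -- The density `q` cancels one of the two factors `1 / q`, so the cost is `1 / p` and not `1 / p
    -- ^ 2`.
    have : q ω * (g ω / q ω) ^ 2 = 1 / q ω * g ω ^ 2 := by field_simp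
    rw [this]; gcongr
  have hmeas : Measurable (A.indicator fun ω => g ω / q ω) :=
    ((hg.mono hm' le_rfl).div (hqm.mono hm le_rfl)).indicator hA
  have hsq : (fun ω => ENNReal.ofReal ((A.indicator (fun ω => g ω / q ω) ω) ^ 2)) =
      A.indicator fun ω => ENNReal.ofReal ((g ω / q ω) ^ 2) := by
    ext ω; by_cases hω : ω ∈ A <;> simp [hω]
  have hlin : ∫⁻ ω, ENNReal.ofReal ((A.indicator (fun ω => g ω / q ω) ω) ^ 2) ∂P ≤
      ENNReal.ofReal (1 / p * ∫ ω, g ω ^ 2 ∂P) := by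
    rw [hsq, lintegral_indicator hA]; exact hle
  have hint : Integrable (fun ω => (A.indicator (fun ω => g ω / q ω) ω) ^ 2) P := by
    refine ⟨(hmeas.pow_const 2).aestronglyMeasurable, ?_⟩
    rw [hasFiniteIntegral_iff_ofReal (Eventually.of_forall fun _ => sq_nonneg _)]
    exact hlin.trans_lt ENNReal.ofReal_lt_top
  refine ⟨(memLp_two_iff_integrable_sq hmeas.aestronglyMeasurable).2 hint, ?_⟩
  rw [integral_eq_lintegral_of_nonneg_ae (Eventually.of_forall fun _ => sq_nonneg _)
    hint.aestronglyMeasurable]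
  refine ENNReal.toReal_le_of_le_ofReal ?_ hlin
  exact mul_nonneg (by positivity) (integral_nonneg fun _ => sq_nonneg _)

/-- Inverse-propensity weighting is unbiased. -/
lemma integral_mul_weighted (hm : m ≤ m0) {V : Ω → ℝ} (hV : Measurable V) {A : Set Ω}
    (hA : MeasurableSet A)
    (h : ∀ T : Set ℝ, MeasurableSet T →
      P⟦A ∩ V ⁻¹' T | m⟧ =ᵐ[P] P⟦A | m⟧ * P⟦V ⁻¹' T | m⟧)
    (hq : ∀ᵐ ω ∂P, 0 < (P⟦A | m⟧) ω) {U g : Ω → ℝ}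
    (hU : Measurable[m ⊔ MeasurableSpace.comap V inferInstance] U)
    (hg : Measurable[m ⊔ MeasurableSpace.comap V inferInstance] g) :
    ∫ ω, U ω * A.indicator (fun ω => g ω / (P⟦A | m⟧) ω) ω ∂P = ∫ ω, U ω * g ω ∂P := by
  have hm' : m ⊔ MeasurableSpace.comap V inferInstance ≤ m0 := sup_le hm hV.comap_le
  have htrim := trim_restrict_eq_trim_withDensity (P := P) hm hV hm' hA h
  set q : Ω → ℝ := P⟦A | m⟧ with hqdef
  have hqm : Measurable[m] q := stronglyMeasurable_condExp.measurable
  have hqm' : Measurable[m ⊔ MeasurableSpace.comap V inferInstance] q :=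
    hqm.mono le_sup_left le_rfl
  have hF : StronglyMeasurable[m ⊔ MeasurableSpace.comap V inferInstance]
      fun ω => U ω * (g ω / q ω) := (hU.mul (hg.div hqm')).stronglyMeasurable
  have e1 : (fun ω => U ω * A.indicator (fun ω => g ω / q ω) ω) =
      A.indicator fun ω => U ω * (g ω / q ω) := by
    ext ω; by_cases hω : ω ∈ A <;> simp [hω]
  rw [e1, integral_indicator hA, integral_trim hm' hF, htrim, ← integral_trim hm' hF,
    integral_withDensity_eq_integral_toReal_smul (hqm.mono hm le_rfl).ennreal_ofReal
      (Eventually.of_forall fun _ => ENNReal.ofReal_lt_top)]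
  refine integral_congr_ae ?_
  filter_upwards [hq] with ω hω
  rw [ENNReal.toReal_ofReal hω.le, smul_eq_mul]
  field_simp

/-- Markov's inequality for the second moment of a deviation. -/
lemma measureReal_le_of_integral_le {F : Ω → ℝ} (hF : Integrable F P) (hF0 : ∀ ω, 0 ≤ F ω)
    {K δ b : ℝ} (hK : ∫ ω, F ω ∂P ≤ K) (hb : 0 < b) (hKb : K ≤ δ * b ^ 2) :
    P.real {ω | ¬ F ω ≤ b ^ 2} ≤ δ := by
  have h1 := mul_meas_ge_le_integral_of_nonneg (Eventually.of_forall hF0) hF (b ^ 2)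
  have h2 : P.real {ω | ¬ F ω ≤ b ^ 2} ≤ P.real {ω | b ^ 2 ≤ F ω} :=
    measureReal_mono fun ω hω => (not_le.1 hω).le
  have hb2 : 0 < b ^ 2 := by positivity
  refine h2.trans (le_of_mul_le_mul_left ?_ hb2)
  linarith

end Weighting

lemma measurable_score {d : ℕ} {p : EuclideanSpace ℝ (Fin d) → ℝ} (hp : ContDiff ℝ 1 p)
    (hp0 : ∀ x, 0 < p x) : Measurable (score p) := by
  have h : ContDiff ℝ 1 fun y => Real.log (p y) := hp.log fun x => (hp0 x).ne'
  have h1 := h.continuous_fderiv one_ne_zero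
  exact (((InnerProductSpace.toDual ℝ _).symm.continuous.comp h1).neg).measurable

/-! ### Measurability along the history of the bandit. -/

namespace Bandit

variable {Ω : Type*} {d L : ℕ} {B : Bandit Ω d L}

lemma past_mono {r s : ℕ} (h : r ≤ s) : B.past r ≤ B.past s :=
  biSup_mono fun _ hk => Finset.Ico_subset_Ico le_rfl h hk

lemma comap_round_le_past {r s : ℕ} (hr : 1 ≤ r) (hrs : r < s) :
    MeasurableSpace.comap (B.X r) inferInstance ⊔ MeasurableSpace.comap (B.arm r) inferInstance ⊔
      MeasurableSpace.comap (B.Y r) inferInstance ≤ B.past s :=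
  le_biSup (fun r => MeasurableSpace.comap (B.X r) inferInstance ⊔
    MeasurableSpace.comap (B.arm r) inferInstance ⊔
      MeasurableSpace.comap (B.Y r) inferInstance) (Finset.mem_Ico.2 ⟨hr, hrs⟩)

lemma measurable_past_X {r s : ℕ} (hr : 1 ≤ r) (hrs : r < s) : Measurable[B.past s] (B.X r) :=
  Measurable.of_comap_le ((le_sup_left.trans le_sup_left).trans (comap_round_le_past hr hrs))

lemma measurable_past_arm {r s : ℕ} (hr : 1 ≤ r) (hrs : r < s) :
    Measurable[B.past s] (B.arm r) :=
  Measurable.of_comap_le ((le_sup_right.trans le_sup_left).trans (comap_round_le_past hr hrs))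

lemma measurable_past_Y {r s : ℕ} (hr : 1 ≤ r) (hrs : r < s) : Measurable[B.past s] (B.Y r) :=
  Measurable.of_comap_le (le_sup_right.trans (comap_round_le_past hr hrs))

lemma measurable_pastX_X (s : ℕ) : Measurable[B.pastX s] (B.X s) :=
  Measurable.of_comap_le le_sup_right

lemma W_apply_sq_le (s : ℕ) (ω : Ω) (j : Fin d) : B.W s ω j ^ 2 ≤ ‖B.W s ω‖ ^ 2 := by
  rw [EuclideanSpace.real_norm_sq_eq]
  exact Finset.single_le_sum (f := fun j => B.W s ω j ^ 2) (fun _ _ => sq_nonneg _)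
    (Finset.mem_univ j)

variable [MeasurableSpace Ω] {P : Measure Ω}

lemma weight_mul_eq_indicator (s : ℕ) (i : Fin L) (g : Ω → ℝ) (ω : Ω) :
    B.weight P s i ω * g ω =
      {ω | B.arm s ω = i}.indicator
        (fun ω => g ω / (P⟦{ω | B.arm s ω = i} | B.pastW s⟧) ω) ω := by
  by_cases h : B.arm s ω = i
  · simp [weight, propensity, h]; ring
  · simp [weight, h]

lemma IsSingleIndexBandit.measurable_score (hB : B.IsSingleIndexBandit P) :
    Measurable (score B.density) :=
  KSIB.measurable_score hB.contDiff_density hB.density_pos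

lemma IsSingleIndexBandit.comap_W_le (hB : B.IsSingleIndexBandit P) (s : ℕ) :
    MeasurableSpace.comap (B.W s) inferInstance ≤ MeasurableSpace.comap (B.X s) inferInstance :=
  (hB.measurable_score.comp (comap_measurable (B.X s))).comap_le

lemma IsSingleIndexBandit.measurable_W (hB : B.IsSingleIndexBandit P) {s : ℕ} (hs : 1 ≤ s) :
    Measurable (B.W s) := hB.measurable_score.comp (hB.measurable_X s hs)

lemma IsSingleIndexBandit.measurable_armReward (hB : B.IsSingleIndexBandit P) {s : ℕ}
    (hs : 1 ≤ s) (i : Fin L) : Measurable (B.armReward s i) := by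
  have := hB.measurable_X s hs
  exact ((hB.measurable_link i).comp (by fun_prop)).add (hB.measurable_noise s hs i)

lemma IsSingleIndexBandit.measurable_Y (hB : B.IsSingleIndexBandit P) {s : ℕ} (hs : 1 ≤ s) :
    Measurable (B.Y s) := by
  have h : Measurable fun q : Fin L × Ω => B.armReward s q.1 q.2 :=
    measurable_from_prod_countable_right fun i => hB.measurable_armReward hs i
  exact h.comp ((hB.measurable_arm s hs).prodMk measurable_id)

lemma IsSingleIndexBandit.past_le (hB : B.IsSingleIndexBandit P) (s : ℕ) :
    B.past s ≤ ‹MeasurableSpace Ω› :=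
  iSup₂_le fun r hr => by
    have h1 := (Finset.mem_Ico.1 hr).1
    exact sup_le (sup_le (hB.measurable_X r h1).comap_le (hB.measurable_arm r h1).comap_le)
      (hB.measurable_Y h1).comap_le

lemma IsSingleIndexBandit.pastW_le (hB : B.IsSingleIndexBandit P) {s : ℕ} (hs : 1 ≤ s) :
    B.pastW s ≤ ‹MeasurableSpace Ω› :=
  sup_le (hB.past_le s) (hB.measurable_W hs).comap_le

lemma IsSingleIndexBandit.pastX_le (hB : B.IsSingleIndexBandit P) {s : ℕ} (hs : 1 ≤ s) :
    B.pastX s ≤ ‹MeasurableSpace Ω› :=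
  sup_le (hB.past_le s) (hB.measurable_X s hs).comap_le

/-- The propensity of round `r` depends only on the earlier history and `W r`, both known before
round `s`. This makes weighted deviations of earlier rounds admissible test functions in round `s`.
-/
lemma IsSingleIndexBandit.measurable_past_weight (hB : B.IsSingleIndexBandit P) {r s : ℕ}
    (hr : 1 ≤ r) (hrs : r < s) (i : Fin L) : Measurable[B.past s] (B.weight P r i) := by
  have h1 : Measurable[B.past s] (B.propensity P r i) :=
    (stronglyMeasurable_condExp.measurable).mono
      (sup_le (past_mono hrs.le) ((hB.comap_W_le r).trans (measurable_past_X hr hrs).comap_le))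
      le_rfl
  have h2 : MeasurableSet[B.past s] {ω | B.arm r ω = i} :=
    measurable_past_arm hr hrs (measurableSet_singleton i)
  exact (Measurable.ite h2 measurable_const measurable_const).div h1

lemma IsSingleIndexBandit.measurable_past_W (hB : B.IsSingleIndexBandit P) {r s : ℕ}
    (hr : 1 ≤ r) (hrs : r < s) : Measurable[B.past s] (B.W r) :=
  hB.measurable_score.comp (measurable_past_X hr hrs)

lemma minPropensity_le_propensity (s : ℕ) (i : Fin L) :
    ∀ᵐ ω ∂P, B.minPropensity P s ≤ B.propensity P s i ω := by
  have h0 : ∀ᵐ ω ∂P, 0 ≤ B.propensity P s i ω := condExp_indicator_one_nonneg _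
  -- The essential infimum of a real function is meaningful only with a lower bound; nonnegativity
  -- of conditional probabilities supplies it.
  have hbdd : IsBoundedUnder (· ≥ ·) (ae P) (B.propensity P s i) := ⟨0, by simpa using h0⟩
  filter_upwards [ae_essInf_le hbdd] with ω hω
  exact (ciInf_le (Set.finite_range _).bddBelow i).trans hω

/-! ### Mean squared error of weighted averages. -/

variable [IsProbabilityMeasure P]

/-- A function of round `s` whose conditional mean given the history and the covariate is a
function of the covariate has the same conditional mean given the history in all rounds. -/
lemma IsSingleIndexBandit.condExp_past_eq (hB : B.IsSingleIndexBandit P) {g : ℕ → Ω → ℝ}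
    {G : EuclideanSpace ℝ (Fin d) → ℝ} (hG : Measurable G)
    (h : ∀ s, 1 ≤ s → P[g s | B.pastX s] =ᵐ[P] G ∘ B.X s) {s : ℕ} (hs : 1 ≤ s) :
    P[g s | B.past s] =ᵐ[P] fun _ => ∫ ω, g 1 ω ∂P := by
  have e : ∀ s, 1 ≤ s → ∫ ω, G (B.X s ω) ∂P = ∫ x, G x ∂(P.map (B.X 1)) := by
    intro s hs
    rw [hB.law_X 1 le_rfl, ← hB.law_X s hs,
      integral_map (hB.measurable_X s hs).aemeasurable hG.aestronglyMeasurable]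
  have e1 : ∫ ω, g 1 ω ∂P = ∫ ω, G (B.X 1 ω) ∂P := by
    rw [← integral_condExp (hB.pastX_le le_rfl)]
    exact integral_congr_ae (h 1 le_rfl)
  have h1 : P[G ∘ B.X s | B.past s] =ᵐ[P] fun _ => ∫ ω, G (B.X s ω) ∂P :=
    condExp_indep_eq (hB.measurable_X s hs).comap_le (hB.past_le s)
      (hG.comp (comap_measurable _)).stronglyMeasurable (hB.indep_X s hs)
  rw [e s hs, ← e 1 le_rfl, ← e1] at h1
  refine EventuallyEq.trans ?_ h1
  exact (condExp_condExp_of_le le_sup_left (hB.pastX_le hs)).symm.trans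
    (condExp_congr_ae (h s hs))

/-- Mean squared error of an inverse-propensity weighted average. -/
lemma integral_sq_weighted_average_sub_le (hB : B.IsSingleIndexBandit P) (hI : B.Ignorable P)
    (hp : ∀ s, 1 ≤ s → 0 < B.minPropensity P s) (i : Fin L) {g : ℕ → Ω → ℝ} {c : ℝ}
    (hgm : ∀ s, 1 ≤ s →
      Measurable[B.pastW s ⊔ MeasurableSpace.comap (B.armReward s i) inferInstance] (g s))
    (hga : ∀ r s, 1 ≤ r → r < s → Measurable[B.past s] fun ω => B.weight P r i ω * g r ω)
    (hg2 : ∀ s, 1 ≤ s → MemLp (g s) 2 P)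
    (hgc : ∀ s, 1 ≤ s → P[g s | B.past s] =ᵐ[P] fun _ => c) {t : ℕ} (ht : 1 ≤ t) :
    Integrable (fun ω =>
      ((t : ℝ)⁻¹ * ∑ s ∈ Finset.Icc 1 t, B.weight P s i ω * g s ω - c) ^ 2) P ∧
    ∫ ω, ((t : ℝ)⁻¹ * ∑ s ∈ Finset.Icc 1 t, B.weight P s i ω * g s ω - c) ^ 2 ∂P ≤
      (∑ s ∈ Finset.Icc 1 t, 1 / B.minPropensity P s * ∫ ω, g s ω ^ 2 ∂P) / (t : ℝ) ^ 2 := by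
  set Z : ℕ → Ω → ℝ := fun s ω => B.weight P s i ω * g s ω with hZ
  have hZe : ∀ s, Z s = {ω | B.arm s ω = i}.indicator
      (fun ω => g s ω / (P⟦{ω | B.arm s ω = i} | B.pastW s⟧) ω) :=
    fun s => funext fun ω => weight_mul_eq_indicator s i (g s) ω
  have hA : ∀ s, 1 ≤ s → MeasurableSet {ω | B.arm s ω = i} :=
    fun s hs => hB.measurable_arm s hs (measurableSet_singleton i)
  have hZ2 : ∀ s, 1 ≤ s → MemLp (Z s) 2 P ∧
      ∫ ω, Z s ω ^ 2 ∂P ≤ 1 / B.minPropensity P s * ∫ ω, g s ω ^ 2 ∂P := by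
    intro s hs
    rw [hZe s]
    exact memLp_two_weighted (hB.pastW_le hs) (hB.measurable_armReward hs i) (hA s hs)
      (hI s hs i) (hp s hs) (minPropensity_le_propensity s i) (hgm s hs) (hg2 s hs)
  -- Unbiasedness against functions of the history. The choice `U = 1` gives the mean of `Z s`, and
  -- `U = D r` with `r < s` gives orthogonality.
  have hun : ∀ s, 1 ≤ s → ∀ U : Ω → ℝ, Measurable[B.past s] U → MemLp U 2 P →
      ∫ ω, U ω * Z s ω ∂P = ∫ ω, U ω * c ∂P := by
    intro s hs U hU hU2
    have h1 : ∫ ω, U ω * Z s ω ∂P = ∫ ω, U ω * g s ω ∂P := by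
      rw [hZe s]
      refine integral_mul_weighted (hB.pastW_le hs) (hB.measurable_armReward hs i) (hA s hs)
        (hI s hs i) ?_ (hU.mono (le_sup_left.trans le_sup_left) le_rfl) (hgm s hs)
      filter_upwards [minPropensity_le_propensity (B := B) (P := P) s i] with ω hω
      exact (hp s hs).trans_le hω
    rw [h1]
    have hUg : Integrable (U * g s) P := hU2.integrable_mul (hg2 s hs)
    have h2 := condExp_mul_of_stronglyMeasurable_left (m := B.past s) (μ := P)
      hU.stronglyMeasurable hUg ((hg2 s hs).integrable one_le_two)
    change ∫ ω, (U * g s) ω ∂P = _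
    rw [← integral_condExp (hB.past_le s)]
    refine integral_congr_ae ?_
    filter_upwards [h2, hgc s hs] with ω h3 h4
    rw [h3, Pi.mul_apply, h4]
  set D : ℕ → Ω → ℝ := fun s ω => Z s ω - c with hD
  have hD2 : ∀ s, 1 ≤ s → MemLp (D s) 2 P := fun s hs => (hZ2 s hs).1.sub (memLp_const c)
  have hZi : ∀ s, 1 ≤ s → Integrable (Z s) P := fun s hs => (hZ2 s hs).1.integrable one_le_two
  have hmean : ∀ s, 1 ≤ s → ∫ ω, Z s ω ∂P = c := by
    intro s hs
    simpa using hun s hs (fun _ => 1) measurable_const (memLp_const 1)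
  have horth : ∀ s ∈ Finset.Icc 1 t, ∀ r ∈ Finset.Icc 1 t, r < s →
      ∫ ω, D r ω * D s ω ∂P = 0 := by
    intro s hs r hr hrs
    have hr1 := (Finset.mem_Icc.1 hr).1
    have hs1 := (Finset.mem_Icc.1 hs).1
    have := hun s hs1 (D r) ((hga r s hr1 hrs).sub measurable_const) (hD2 r hr1)
    have e : (fun ω => D r ω * D s ω) = fun ω => D r ω * Z s ω - D r ω * c := by
      ext ω; simp only [hD]; ring
    have hDZ : Integrable (fun ω => D r ω * Z s ω) P := (hD2 r hr1).integrable_mul (hZ2 s hs1).1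
    rw [e, integral_sub hDZ (((hD2 r hr1).integrable one_le_two).mul_const c), this, sub_self]
  -- A variance is at most the second moment.
  have hDle : ∀ s, 1 ≤ s →
      ∫ ω, D s ω ^ 2 ∂P ≤ 1 / B.minPropensity P s * ∫ ω, g s ω ^ 2 ∂P := by
    intro s hs
    refine le_trans ?_ (hZ2 s hs).2
    have e : (fun ω => D s ω ^ 2) = fun ω => Z s ω ^ 2 - (2 * c * Z s ω - c ^ 2) := by
      ext ω; simp only [hD]; ring
    have hlin : Integrable (fun ω => 2 * c * Z s ω - c ^ 2) P :=
      ((hZi s hs).const_mul _).sub (integrable_const _)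
    rw [e, integral_sub (hZ2 s hs).1.integrable_sq hlin,
      integral_sub ((hZi s hs).const_mul _) (integrable_const _), integral_const_mul, hmean s hs]
    simp
    nlinarith [sq_nonneg c]
  have ht0 : (t : ℝ) ≠ 0 := by positivity
  have e : (fun ω => ((t : ℝ)⁻¹ * ∑ s ∈ Finset.Icc 1 t, Z s ω - c) ^ 2) =
      fun ω => (∑ s ∈ Finset.Icc 1 t, D s ω) ^ 2 / (t : ℝ) ^ 2 := by
    ext ω
    simp only [hD, Finset.sum_sub_distrib, Finset.sum_const, Nat.card_Icc, Nat.add_sub_cancel,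
      nsmul_eq_mul]
    field_simp
  have hsum : MemLp (fun ω => ∑ s ∈ Finset.Icc 1 t, D s ω) 2 P :=
    memLp_finsetSum _ fun s hs => hD2 s (Finset.mem_Icc.1 hs).1
  rw [e]
  refine ⟨hsum.integrable_sq.div_const _, ?_⟩
  rw [integral_div, integral_sum_sq_of_orthogonal
    (fun s hs => hD2 s (Finset.mem_Icc.1 hs).1) horth]
  gcongr with s hs
  exact hDle s (Finset.mem_Icc.1 hs).1

end Bandit

/-! ### Moment envelopes as Bochner integrals, and the deviation bounds. -/

lemma integrable_norm_pow_and_integral_le {Ω E : Type*} [MeasurableSpace Ω] {P : Measure Ω}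
    [NormedAddCommGroup E] {f : Ω → E} (hf : AEStronglyMeasurable f P) {n : ℕ} {M : ℝ≥0}
    (h : ∫⁻ ω, ‖f ω‖ₑ ^ n ∂P ≤ M) :
    Integrable (fun ω => ‖f ω‖ ^ n) P ∧ ∫ ω, ‖f ω‖ ^ n ∂P ≤ M := by
  have e : ∀ ω, ENNReal.ofReal (‖f ω‖ ^ n) = ‖f ω‖ₑ ^ n := fun ω => by
    rw [ENNReal.ofReal_pow (norm_nonneg _), ofReal_norm]
  have h0 : 0 ≤ᵐ[P] fun ω => ‖f ω‖ ^ n := Eventually.of_forall fun _ => by positivity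
  have hi : Integrable (fun ω => ‖f ω‖ ^ n) P := by
    refine ⟨hf.norm.pow n, ?_⟩
    rw [hasFiniteIntegral_iff_ofReal h0]
    simp_rw [e]
    exact h.trans_lt ENNReal.coe_lt_top
  refine ⟨hi, ?_⟩
  rw [integral_eq_lintegral_of_nonneg_ae h0 hi.1]
  simp_rw [e]
  exact ENNReal.toReal_le_coe_of_le_coe h

/-- Only the summand with `C₃` and the strictly positive `η` are needed. The truncation level is
nonnegative because its maximum contains `log (1 / η) ≥ 0`, and a real square root is nonnegative
whatever its argument. -/
lemma momentBound_bounds {c C M₈ C₂ c₂ C₃ : ℝ} {d t : ℕ} {r δ η : ℝ} (hc : 0 < c)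
    (hC₃ : 0 ≤ C₃) (hr : 0 ≤ r) (hδ : δ ∈ Set.Ioo (0 : ℝ) (1 / 2))
    (hη : η ∈ Set.Ioo (0 : ℝ) (1 / 2)) :
    0 < momentBound c C M₈ C₂ c₂ C₃ d t r δ η ∧
      C₃ * r ≤ δ * momentBound c C M₈ C₂ c₂ C₃ d t r δ η ^ 2 := by
  obtain ⟨hδ0, hδ1⟩ := hδ
  obtain ⟨hη0, hη1⟩ := hη
  have hlog : 0 ≤ Real.log (2 * d / δ) := by
    -- For `d = 0` the convention `log 0 = 0` applies.
    rcases Nat.eq_zero_or_pos d with rfl | hd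
    · simp
    · refine Real.log_nonneg ?_
      rw [le_div_iff₀ hδ0]
      have : (1 : ℝ) ≤ d := by exact_mod_cast hd
      linarith
  have hu : 0 ≤ truncSq c (M₈ * C) t r η := by
    refine mul_nonneg (by positivity) (le_max_of_le_left (Real.log_nonneg ?_))
    rw [le_div_iff₀ hη0]; linarith
  have hs : 0 ≤ √(C₃ / δ) * √r := by positivity
  have hle : √(C₃ / δ) * √r + η ≤ momentBound c C M₈ C₂ c₂ C₃ d t r δ η := by
    unfold momentBound
    have h1 : 0 ≤ 4 / 3 * truncSq c (M₈ * C) t r η * (Real.log (2 * d / δ) / t) := by positivity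
    have h2 := Real.sqrt_nonneg ((C₂ * r + c₂ / t) * Real.log (2 * d / δ))
    linarith
  refine ⟨by linarith, ?_⟩
  have h3 : (√(C₃ / δ) * √r) ^ 2 ≤ momentBound c C M₈ C₂ c₂ C₃ d t r δ η ^ 2 :=
    pow_le_pow_left₀ hs (by linarith) 2
  rw [mul_pow, Real.sq_sqrt (by positivity), Real.sq_sqrt hr] at h3
  calc C₃ * r = δ * (C₃ / δ * r) := by field_simp
    _ ≤ _ := by gcongr

/-! ### Deviations of the Gram matrix and of the moment vector. -/

namespace Bandit

variable {Ω : Type*} {d L : ℕ} {B : Bandit Ω d L} [MeasurableSpace Ω] {P : Measure Ω}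
  {i : Fin L} {M₂ M₄ M₈ N₂ N₄ : ℝ≥0} {κ : ℝ}

lemma r_nonneg (hp : ∀ s, 1 ≤ s → 0 < B.minPropensity P s) (t : ℕ) : 0 ≤ B.r P t :=
  div_nonneg (Finset.sum_nonneg fun s hs =>
    (one_div_pos.2 (hp s (Finset.mem_Icc.1 hs).1)).le) (sq_nonneg _)

/-- Exchanging the sums lets the coordinates be summed within each round, so that the bound involves
a norm of the feature and no factor of the dimension. -/
lemma sum_sum_le_mul_r {ι : Type*} (S : Finset ι) {E : ι → ℕ → ℝ} {K : ℝ}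
    (hp : ∀ s, 1 ≤ s → 0 < B.minPropensity P s)
    (hE : ∀ s, 1 ≤ s → ∑ j ∈ S, E j s ≤ K) (t : ℕ) :
    ∑ j ∈ S, (∑ s ∈ Finset.Icc 1 t, 1 / B.minPropensity P s * E j s) / (t : ℝ) ^ 2 ≤
      K * B.r P t := by
  rw [← Finset.sum_div, Finset.sum_comm, r, ← mul_div_assoc, Finset.mul_sum]
  refine div_le_div_of_nonneg_right (Finset.sum_le_sum fun s hs => ?_) (sq_nonneg _)
  have hs1 := (Finset.mem_Icc.1 hs).1
  have := hp s hs1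
  rw [← Finset.mul_sum, mul_comm K]
  gcongr
  exact hE s hs1

variable [IsProbabilityMeasure P]

lemma integrable_and_integral_gramHat_sub_le (hB : B.IsSingleIndexBandit P) (hI : B.Ignorable P)
    (hp : ∀ s, 1 ≤ s → 0 < B.minPropensity P s)
    (hM : B.MomentEnvelopes P i M₂ M₄ M₈ N₂ N₄ κ) {t : ℕ} (ht : 1 ≤ t) :
    Integrable (fun ω => ∑ j, ∑ k, (B.gramHat P i t ω j k - B.gram P j k) ^ 2) P ∧
      ∫ ω, ∑ j, ∑ k, (B.gramHat P i t ω j k - B.gram P j k) ^ 2 ∂P ≤ M₄ * B.r P t := by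
  have hcoord : ∀ j, Measurable fun x : EuclideanSpace ℝ (Fin d) => x j := fun j => by fun_prop
  have hWm : ∀ s, 1 ≤ s → Measurable (B.W s) := fun s hs => hB.measurable_W hs
  have h4 : ∀ s, 1 ≤ s → Integrable (fun ω => ‖B.W s ω‖ ^ 4) P ∧ ∫ ω, ‖B.W s ω‖ ^ 4 ∂P ≤ M₄ :=
    fun s hs => integrable_norm_pow_and_integral_le (hWm s hs).aestronglyMeasurable
      (hM.feature_four s hs)
  set g : Fin d → Fin d → ℕ → Ω → ℝ := fun j k s ω => B.W s ω j * B.W s ω k with hg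
  have hgmeas : ∀ j k s, 1 ≤ s → Measurable (g j k s) := fun j k s hs => by
    have := hWm s hs
    fun_prop
  have hg2 : ∀ j k s, 1 ≤ s → MemLp (g j k s) 2 P := by
    intro j k s hs
    refine (memLp_two_iff_integrable_sq (hgmeas j k s hs).aestronglyMeasurable).2 ?_
    refine (h4 s hs).1.mono' ((hgmeas j k s hs).pow_const 2).aestronglyMeasurable
      (Eventually.of_forall fun ω => ?_)
    rw [Real.norm_of_nonneg (sq_nonneg _)]
    calc g j k s ω ^ 2 = B.W s ω j ^ 2 * B.W s ω k ^ 2 := by simp only [hg]; ring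
      _ ≤ ‖B.W s ω‖ ^ 2 * ‖B.W s ω‖ ^ 2 := by
        exact mul_le_mul (W_apply_sq_le s ω j) (W_apply_sq_le s ω k) (sq_nonneg _) (sq_nonneg _)
      _ = _ := by ring
  have hgm : ∀ j k s, 1 ≤ s →
      Measurable[B.pastW s ⊔ MeasurableSpace.comap (B.armReward s i) inferInstance] (g j k s) := by
    intro j k s hs
    have h1 : Measurable[B.pastW s ⊔ MeasurableSpace.comap (B.armReward s i) inferInstance]
        (B.W s) := Measurable.of_comap_le (le_sup_right.trans le_sup_left)
    exact Measurable.mul ((hcoord j).comp h1) ((hcoord k).comp h1)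
  have hga : ∀ j k r s, 1 ≤ r → r < s →
      Measurable[B.past s] fun ω => B.weight P r i ω * g j k r ω := by
    intro j k r s hr hrs
    have h1 := hB.measurable_past_W hr hrs
    exact (hB.measurable_past_weight hr hrs i).mul
      (Measurable.mul ((hcoord j).comp h1) ((hcoord k).comp h1))
  have hgc : ∀ j k s, 1 ≤ s → P[g j k s | B.past s] =ᵐ[P] fun _ => ∫ ω, g j k 1 ω ∂P := by
    intro j k s hs
    have hG : Measurable fun x => score B.density x j * score B.density x k :=
      ((hcoord j).comp hB.measurable_score).mul ((hcoord k).comp hB.measurable_score)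
    refine hB.condExp_past_eq hG (fun s hs => ?_) hs
    have h1 : StronglyMeasurable[B.pastX s] (g j k s) :=
      (hG.comp (measurable_pastX_X s)).stronglyMeasurable
    rw [condExp_of_stronglyMeasurable (hB.pastX_le hs) h1
      ((hg2 j k s hs).integrable one_le_two)]
    rfl
  have hmse := fun j k => integral_sq_weighted_average_sub_le hB hI hp i (hgm j k) (hga j k)
    (hg2 j k) (hgc j k) ht
  have e : (fun ω => ∑ j, ∑ k, (B.gramHat P i t ω j k - B.gram P j k) ^ 2) =
      fun ω => ∑ j, ∑ k, ((t : ℝ)⁻¹ * ∑ s ∈ Finset.Icc 1 t, B.weight P s i ω * g j k s ω -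
        ∫ ω, g j k 1 ω ∂P) ^ 2 := by
    ext ω
    simp [gramHat, gram, hg, Matrix.sum_apply]
  rw [e]
  refine ⟨integrable_finsetSum _ fun j _ => integrable_finsetSum _ fun k _ => (hmse j k).1, ?_⟩
  rw [integral_finsetSum _ fun j _ => integrable_finsetSum _ fun k _ => (hmse j k).1]
  simp_rw [integral_finsetSum _ fun k _ => (hmse _ k).1]
  -- The squared Frobenius norm of `W Wᵀ` is `‖W‖ ^ 4`, whence the constant `M₄`.
  have hsq : ∀ s ω, ∑ q : Fin d × Fin d, g q.1 q.2 s ω ^ 2 = ‖B.W s ω‖ ^ 4 := by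
    intro s ω
    have : ‖B.W s ω‖ ^ 4 = ‖B.W s ω‖ ^ 2 * ‖B.W s ω‖ ^ 2 := by ring
    rw [this, EuclideanSpace.real_norm_sq_eq, Finset.sum_mul_sum, Fintype.sum_prod_type]
    exact Finset.sum_congr rfl fun j _ => Finset.sum_congr rfl fun k _ => mul_pow _ _ 2
  have hle : ∀ s, 1 ≤ s → ∑ q : Fin d × Fin d, ∫ ω, g q.1 q.2 s ω ^ 2 ∂P ≤ M₄ := by
    intro s hs
    rw [← integral_finsetSum _ fun q _ => (hg2 q.1 q.2 s hs).integrable_sq]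
    simp_rw [hsq]
    exact (h4 s hs).2
  refine le_trans ?_ (sum_sum_le_mul_r Finset.univ
    (E := fun q : Fin d × Fin d => fun s => ∫ ω, g q.1 q.2 s ω ^ 2 ∂P) hp hle t)
  rw [Fintype.sum_prod_type]
  exact Finset.sum_le_sum fun j _ => Finset.sum_le_sum fun k _ => (hmse j k).2

lemma IsSingleIndexBandit.condExp_armReward (hB : B.IsSingleIndexBandit P) {s : ℕ} (hs : 1 ≤ s)
    (hY : Integrable (B.armReward s i) P) :
    P[B.armReward s i | B.pastX s] =ᵐ[P]
      fun ω => B.link i (inner ℝ (B.X s ω) (B.index i)) := by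
  have hf : Measurable fun x => B.link i (inner ℝ x (B.index i)) :=
    (hB.measurable_link i).comp (by fun_prop)
  have hn := hB.integrable_noise s hs i
  have hfi : Integrable (fun ω => B.link i (inner ℝ (B.X s ω) (B.index i))) P := by
    refine (hY.sub hn).congr (Eventually.of_forall fun ω => ?_)
    simp [armReward]
  have hfm : StronglyMeasurable[B.pastX s]
      fun ω => B.link i (inner ℝ (B.X s ω) (B.index i)) :=
    (hf.comp (measurable_pastX_X s)).stronglyMeasurable
  have h1 := condExp_of_stronglyMeasurable (hB.pastX_le hs) hfm hfi
  have h2 := condExp_add hfi hn (B.pastX s)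
  filter_upwards [h2, hB.noise_centred s hs i] with ω h3 h4
  refine h3.trans ?_
  rw [Pi.add_apply, h1, h4]
  simp

lemma integrable_and_integral_momentHat_sub_le (hB : B.IsSingleIndexBandit P)
    (hI : B.Ignorable P) (hp : ∀ s, 1 ≤ s → 0 < B.minPropensity P s)
    (hM : B.MomentEnvelopes P i M₂ M₄ M₈ N₂ N₄ κ) {t : ℕ} (ht : 1 ≤ t) :
    Integrable (fun ω => ‖B.momentHat P i t ω - B.moment P i‖ ^ 2) P ∧
      ∫ ω, ‖B.momentHat P i t ω - B.moment P i‖ ^ 2 ∂P ≤ (M₄ + N₄) / 2 * B.r P t := by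
  have hcoord : ∀ j, Measurable fun x : EuclideanSpace ℝ (Fin d) => x j := fun j => by fun_prop
  have hWm : ∀ s, 1 ≤ s → Measurable (B.W s) := fun s hs => hB.measurable_W hs
  have hYm : ∀ s, 1 ≤ s → Measurable (B.armReward s i) :=
    fun s hs => hB.measurable_armReward hs i
  have h4 : ∀ s, 1 ≤ s → Integrable (fun ω => ‖B.W s ω‖ ^ 4) P ∧ ∫ ω, ‖B.W s ω‖ ^ 4 ∂P ≤ M₄ :=
    fun s hs => integrable_norm_pow_and_integral_le (hWm s hs).aestronglyMeasurable
      (hM.feature_four s hs)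
  have hY4 : ∀ s, 1 ≤ s → Integrable (fun ω => ‖B.armReward s i ω‖ ^ 4) P ∧
      ∫ ω, ‖B.armReward s i ω‖ ^ 4 ∂P ≤ N₄ :=
    fun s hs => integrable_norm_pow_and_integral_le (hYm s hs).aestronglyMeasurable
      (hM.reward_four s hs)
  have hYi : ∀ s, 1 ≤ s → Integrable (B.armReward s i) P := by
    intro s hs
    refine MemLp.integrable one_le_two
      ((memLp_two_iff_integrable_sq (hYm s hs).aestronglyMeasurable).2 ?_)
    have := (integrable_norm_pow_and_integral_le (hYm s hs).aestronglyMeasurable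
      (hM.reward_two s hs)).1
    simpa using this
  set H : ℕ → Ω → ℝ := fun s ω => (‖B.W s ω‖ ^ 4 + ‖B.armReward s i ω‖ ^ 4) / 2 with hH
  have hHi : ∀ s, 1 ≤ s → Integrable (H s) P :=
    fun s hs => ((h4 s hs).1.add (hY4 s hs).1).div_const 2
  have hHle : ∀ s, 1 ≤ s → ∫ ω, H s ω ∂P ≤ (M₄ + N₄) / 2 := by
    intro s hs
    rw [integral_div, integral_add (h4 s hs).1 (hY4 s hs).1]
    linarith [(h4 s hs).2, (hY4 s hs).2]
  -- By the arithmetic–geometric mean inequality; this is the source of the constant `(M₄ + N₄) /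
  -- 2`.
  have hWY : ∀ s ω, ‖B.W s ω‖ ^ 2 * B.armReward s i ω ^ 2 ≤ H s ω := by
    intro s ω
    have e : ‖B.armReward s i ω‖ ^ 4 = (B.armReward s i ω ^ 2) ^ 2 := by
      rw [Real.norm_eq_abs, ← sq_abs (B.armReward s i ω)]; ring
    simp only [hH, e]
    nlinarith [sq_nonneg (‖B.W s ω‖ ^ 2 - B.armReward s i ω ^ 2)]
  set g : Fin d → ℕ → Ω → ℝ := fun j s ω => B.W s ω j * B.armReward s i ω with hg
  have hgmeas : ∀ j s, 1 ≤ s → Measurable (g j s) := fun j s hs => by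
    have := hWm s hs
    have := hYm s hs
    fun_prop
  have hg2 : ∀ j s, 1 ≤ s → MemLp (g j s) 2 P := by
    intro j s hs
    refine (memLp_two_iff_integrable_sq (hgmeas j s hs).aestronglyMeasurable).2 ?_
    refine (hHi s hs).mono' ((hgmeas j s hs).pow_const 2).aestronglyMeasurable
      (Eventually.of_forall fun ω => ?_)
    rw [Real.norm_of_nonneg (sq_nonneg _)]
    refine le_trans ?_ (hWY s ω)
    simp only [hg, mul_pow]
    exact mul_le_mul_of_nonneg_right (W_apply_sq_le s ω j) (sq_nonneg _)
  have hgm : ∀ j s, 1 ≤ s →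
      Measurable[B.pastW s ⊔ MeasurableSpace.comap (B.armReward s i) inferInstance] (g j s) := by
    intro j s hs
    have h1 : Measurable[B.pastW s ⊔ MeasurableSpace.comap (B.armReward s i) inferInstance]
        (B.W s) := Measurable.of_comap_le (le_sup_right.trans le_sup_left)
    have h2 : Measurable[B.pastW s ⊔ MeasurableSpace.comap (B.armReward s i) inferInstance]
        (B.armReward s i) := Measurable.of_comap_le le_sup_right
    exact Measurable.mul ((hcoord j).comp h1) h2
  have hga : ∀ j r s, 1 ≤ r → r < s →
      Measurable[B.past s] fun ω => B.weight P r i ω * g j r ω := by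
    intro j r s hr hrs
    -- The potential reward of arm `i` need not be measurable for the history, but the weight
    -- vanishes unless arm `i` was selected, and then it equals the observed reward.
    have e : (fun ω => B.weight P r i ω * g j r ω) =
        fun ω => B.weight P r i ω * (B.W r ω j * B.Y r ω) := by
      ext ω
      by_cases h : B.arm r ω = i
      · simp [hg, Y, h]
      · simp [weight, h]
    rw [e]
    exact (hB.measurable_past_weight hr hrs i).mul
      (Measurable.mul ((hcoord j).comp (hB.measurable_past_W hr hrs)) (measurable_past_Y hr hrs))
  have hgc : ∀ j s, 1 ≤ s → P[g j s | B.past s] =ᵐ[P] fun _ => ∫ ω, g j 1 ω ∂P := by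
    intro j s hs
    have hS : Measurable fun x => score B.density x j := (hcoord j).comp hB.measurable_score
    have hG : Measurable fun x => score B.density x j * B.link i (inner ℝ x (B.index i)) :=
      hS.mul ((hB.measurable_link i).comp (by fun_prop))
    refine hB.condExp_past_eq hG (fun s hs => ?_) hs
    have hWj : StronglyMeasurable[B.pastX s] fun ω => B.W s ω j :=
      (hS.comp (measurable_pastX_X s)).stronglyMeasurable
    refine (condExp_mul_of_stronglyMeasurable_left hWj
      ((hg2 j s hs).integrable one_le_two) (hYi s hs)).trans ?_
    filter_upwards [hB.condExp_armReward hs (hYi s hs)] with ω h2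
    rw [Pi.mul_apply, h2]
    rfl
  have hmse := fun j => integral_sq_weighted_average_sub_le hB hI hp i (hgm j) (hga j)
    (hg2 j) (hgc j) ht
  have hm : ∀ j, B.moment P i j = ∫ ω, g j 1 ω ∂P := by
    intro j
    have h1 : ∀ j, Integrable (fun ω => (B.armReward 1 i ω • B.W 1 ω) j) P := by
      intro j
      refine ((hg2 j 1 le_rfl).integrable one_le_two).congr (Eventually.of_forall fun ω => ?_)
      simp [hg, mul_comm]
    rw [moment, eval_integral_piLp h1]
    refine integral_congr_ae (Eventually.of_forall fun ω => ?_)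
    simp [hg, mul_comm]
  have e : (fun ω => ‖B.momentHat P i t ω - B.moment P i‖ ^ 2) =
      fun ω => ∑ j, ((t : ℝ)⁻¹ * ∑ s ∈ Finset.Icc 1 t, B.weight P s i ω * g j s ω -
        ∫ ω, g j 1 ω ∂P) ^ 2 := by
    ext ω
    rw [EuclideanSpace.real_norm_sq_eq]
    refine Finset.sum_congr rfl fun j _ => ?_
    rw [PiLp.sub_apply, hm j]
    have h2 : B.momentHat P i t ω j =
        (t : ℝ)⁻¹ * ∑ s ∈ Finset.Icc 1 t, B.weight P s i ω * g j s ω := by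
      simp only [momentHat, PiLp.smul_apply, smul_eq_mul, WithLp.ofLp_sum, Finset.sum_apply]
      congr 1
      refine Finset.sum_congr rfl fun s _ => ?_
      by_cases h : B.arm s ω = i
      · simp only [Y, h, hg]; ring
      · simp [weight, h]
    rw [h2]
  rw [e]
  refine ⟨integrable_finsetSum _ fun j _ => (hmse j).1, ?_⟩
  rw [integral_finsetSum _ fun j _ => (hmse j).1]
  refine (Finset.sum_le_sum fun j _ => (hmse j).2).trans
    (sum_sum_le_mul_r Finset.univ (E := fun j s => ∫ ω, g j s ω ^ 2 ∂P) hp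
      (fun s hs => ?_) t)
  rw [← integral_finsetSum _ fun j _ => (hg2 j s hs).integrable_sq]
  refine le_trans (integral_mono (integrable_finsetSum _ fun j _ => (hg2 j s hs).integrable_sq)
    (hHi s hs) fun ω => ?_) (hHle s hs)
  refine le_trans (le_of_eq ?_) (hWY s ω)
  simp only [hg, mul_pow, EuclideanSpace.real_norm_sq_eq, Finset.sum_mul]

/-- On an event of probability at least `1 - δΓ - δm`, which the second moments of the deviations
provide, the weighted estimator satisfies the perturbation bound. -/
lemma one_sub_le_measureReal_betaHat (hB : B.IsSingleIndexBandit P) (hI : B.Ignorable P)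
    (hp : ∀ s, 1 ≤ s → 0 < B.minPropensity P s)
    (hM : B.MomentEnvelopes P i M₂ M₄ M₈ N₂ N₄ κ) {μ : ℝ} (hμ0 : 0 < μ)
    (hμ : ∀ l ∈ spectrum ℝ (B.gram P), μ ≤ l) {t : ℕ} (ht : 1 ≤ t) {δΓ δm a b : ℝ}
    (ha : 0 < a) (haμ : a < μ) (haδ : M₄ * B.r P t ≤ δΓ * a ^ 2)
    (hb : 0 < b) (hbδ : (M₄ + N₄) / 2 * B.r P t ≤ δm * b ^ 2) :
    1 - δΓ - δm ≤ P.real {ω | IsUnit (B.gramHat P i t ω) ∧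
      ‖B.betaHat P i t ω - B.beta P i‖ ≤
        1 / μ * b + a / (μ ^ 2 - μ * a) * (‖B.moment P i‖ + b)} := by
  have hG := integrable_and_integral_gramHat_sub_le hB hI hp hM ht
  have hm := integrable_and_integral_momentHat_sub_le hB hI hp hM ht
  have h1 := measureReal_le_of_integral_le hG.1
    (fun ω => Finset.sum_nonneg fun j _ => Finset.sum_nonneg fun k _ => sq_nonneg _) hG.2 ha haδ
  have h2 := measureReal_le_of_integral_le hm.1 (fun ω => sq_nonneg _) hm.2 hb hbδ
  have hsymm : (B.gram P).IsHermitian := by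
    ext j k
    simp [gram, Matrix.conjTranspose_apply, mul_comm]
  set S := {ω | IsUnit (B.gramHat P i t ω) ∧ ‖B.betaHat P i t ω - B.beta P i‖ ≤
    1 / μ * b + a / (μ ^ 2 - μ * a) * (‖B.moment P i‖ + b)} with hS
  set R₁ := {ω | ¬ ∑ j, ∑ k, (B.gramHat P i t ω j k - B.gram P j k) ^ 2 ≤ a ^ 2}
  set R₂ := {ω | ¬ ‖B.momentHat P i t ω - B.moment P i‖ ^ 2 ≤ b ^ 2}
  -- Covering the whole space and using subadditivity requires no measurability of `S`.
  have hcover : Set.univ ⊆ S ∪ (R₁ ∪ R₂) := by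
    intro ω _
    by_cases hω : ω ∈ R₁ ∪ R₂
    · exact Or.inr hω
    · simp only [Set.mem_union, not_or, R₁, R₂, Set.mem_ofPred_eq, not_not] at hω
      exact Or.inl (isUnit_and_norm_inv_sub_inv_le hsymm hμ hμ0 ha.le haμ hω.1
        (le_of_sq_le_sq hω.2 hb.le))
  have h3 : P.real Set.univ ≤ P.real S + (P.real R₁ + P.real R₂) :=
    (measureReal_mono hcover).trans ((measureReal_union_le _ _).trans
      (add_le_add_right (measureReal_union_le _ _) _))
  rw [probReal_univ] at h3
  linarith

end Bandit

end KSIB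

/-! ### Choice of constants and conclusion. -/

theorem mainTheorem8 :
    ∃ cΓ > (0 : ℝ), ∃ cm > (0 : ℝ),
    ∀ M₂ M₄ M₈ N₂ N₄ : ℝ≥0,
    ∃ CΓ > (0 : ℝ), ∃ m₂ ≥ (0 : ℝ),
    ∃ N₈ > (0 : ℝ), ∃ Cm > (0 : ℝ), ∃ C₂ ≥ (0 : ℝ), ∃ c₂ ≥ (0 : ℝ), ∃ C₃ ≥ (0 : ℝ),
    ∀ (Ω : Type*) [MeasurableSpace Ω] (P : Measure Ω) [IsProbabilityMeasure P] (d L : ℕ)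
      (B : KSIB.Bandit Ω d L) (i : Fin L) (κ μ : ℝ),
      B.IsSingleIndexBandit P → B.Ignorable P → B.AverageExploration P →
      0 < κ → B.NoDominantWeight P κ → B.MomentEnvelopes P i M₂ M₄ M₈ N₂ N₄ κ →
      0 < μ → (∀ l ∈ spectrum ℝ (B.gram P), μ ≤ l) →
    ∀ δΓ ηΓ δm ηm : ℝ, δΓ ∈ Set.Ioo (0 : ℝ) (1 / 2) → ηΓ ∈ Set.Ioo (0 : ℝ) (1 / 2) →
      δm ∈ Set.Ioo (0 : ℝ) (1 / 2) → ηm ∈ Set.Ioo (0 : ℝ) (1 / 2) →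
    ∀ t : ℕ, 1 ≤ t →
    ∀ BΓ Bm : ℝ,
      BΓ = KSIB.gramBound cΓ CΓ M₄ M₈ m₂ d t (B.r P t) δΓ ηΓ →
      Bm = KSIB.momentBound cm Cm N₈ C₂ c₂ C₃ d t (B.r P t) δm ηm →
      (BΓ < μ →
        1 - (2 * δΓ + ηΓ) - (2 * δm + ηm) ≤
          P.real {ω | IsUnit (B.gramHat P i t ω) ∧
            ‖B.betaHat P i t ω - B.beta P i‖ ≤
              1 / μ * Bm + BΓ / (μ ^ 2 - μ * BΓ) * (‖B.moment P i‖ + Bm)}) ∧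
      (BΓ ≤ μ / 2 →
        1 - (2 * δΓ + ηΓ) - (2 * δm + ηm) ≤
          P.real {ω | IsUnit (B.gramHat P i t ω) ∧
            ‖B.betaHat P i t ω - B.beta P i‖ ≤
              1 / μ * Bm + 2 / μ ^ 2 * BΓ * (‖B.moment P i‖ + Bm)}) := by
  -- The value that matters is `C₃ = (M₄ + N₄) / 2`, the constant in the mean squared error of the
  -- moment; the others only need the right signs.
  refine ⟨1, one_pos, 1, one_pos, fun M₂ M₄ M₈ N₂ N₄ => ⟨1, one_pos, M₂, M₂.2, M₈ + N₄ + 1,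
    by positivity, 1, one_pos, 4 * ((M₄ + N₄) / 2), by positivity, 4 * (M₂ * N₂), by positivity,
    (M₄ + N₄) / 2, by positivity, ?_⟩⟩
  intro Ω _ P _ d L B i κ μ hB hI hE _ _ hM hμ0 hμ δΓ ηΓ δm ηm hδΓ hηΓ hδm hηm t ht BΓ Bm hBΓ hBm
  have hp := hE.1
  have hr := KSIB.Bandit.r_nonneg hp t
  have hΓ : 0 < BΓ ∧ M₄ * B.r P t ≤ δΓ * BΓ ^ 2 := by
    rw [hBΓ]
    -- By definition `gramBound` is `momentBound` with `C₂ = 4 M₄`, `c₂ = 4 m₂ ^ 2` and `C₃ = M₄`.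
    exact KSIB.momentBound_bounds (C₂ := 4 * M₄) (c₂ := 4 * (M₂ : ℝ) ^ 2) one_pos M₄.2 hr hδΓ hηΓ
  have hm : 0 < Bm ∧ (M₄ + N₄) / 2 * B.r P t ≤ δm * Bm ^ 2 := by
    rw [hBm]
    exact KSIB.momentBound_bounds one_pos (by positivity) hr hδm hηm
  have key : BΓ < μ → 1 - (2 * δΓ + ηΓ) - (2 * δm + ηm) ≤
      P.real {ω | IsUnit (B.gramHat P i t ω) ∧ ‖B.betaHat P i t ω - B.beta P i‖ ≤
        1 / μ * Bm + BΓ / (μ ^ 2 - μ * BΓ) * (‖B.moment P i‖ + Bm)} := by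
    intro hlt
    have := KSIB.Bandit.one_sub_le_measureReal_betaHat hB hI hp hM hμ0 hμ ht hΓ.1 hlt hΓ.2
      hm.1 hm.2
    linarith [hδΓ.1, hηΓ.1, hδm.1, hηm.1]
  refine ⟨key, fun hle => (key (by linarith)).trans (measureReal_mono fun ω hω => ?_)⟩
  refine ⟨hω.1, hω.2.trans ?_⟩
  have h1 : 0 < μ ^ 2 - μ * BΓ := by nlinarith
  -- From `BΓ ≤ μ / 2` the denominator is at least `μ ^ 2 / 2`.
  have h2 : BΓ / (μ ^ 2 - μ * BΓ) ≤ 2 / μ ^ 2 * BΓ := by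
    rw [div_mul_eq_mul_div, div_le_div_iff₀ h1 (by positivity)]
    nlinarith [mul_nonneg (mul_nonneg hΓ.1.le hμ0.le) (sub_nonneg.2 hle)]
  have := hm.1
  gcongr
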